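/- Let $S=\mathbb{Z}[A,B]$ and let $E$ be the cubic $y^2=x^3+Ax+B$ over $S$, with division polynomials $\psi_n$ and $\phi_n=x\psi_n^2-\psi_{n+1}\psi_{n-1}$; modulo the equation of $E$, both $\phi_n$ and $\widetilde\psi_n:=\psi_n^2$ are polynomials in $S[x]$. For an integer $n\ge 0$, let $[n]:\mathbb{A}^2_S\to\mathbb{A}^2_S$ be the polynomial map $$[n](X,Z)=\left(Z^{n^2}\phi_n\!\left(\tfrac XZ\right),\ Z^{n^2}\widetilde\psi_n\!\left(\tfrac XZ\right)\right),$$ and let $J_n\in \mathrm{Mat}_2(S[X,Z])$ be its Jacobian matrix (with $(i,j)$-entry the derivative of the $i$-th coordinate with respect to the $j$-th variable). Call $M$ a right divisor of $N$ in $\mathrm{Mat}_2(R)$ if $N=QM$ for some $Q\in\mathrm{Mat}_2(R)$. Then: 1. $[mn]=[m]\circ[n]$ for all $m,n\ge 0$, and $n\mapsto[n]$ is injective. 2. In the field of fractions of $S[X,Z]$, for all $n\ge 0$, $$J_n=Z^{n^2-2}\begin{pmatrix} Z\phi_n'(X/Z) & n^2Z\phi_n(X/Z)-X\phi_n'(X/Z)\\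 Z\widetilde\psi_n'(X/Z) & n^2Z\widetilde\psi_n(X/Z)-X\widetilde\psi_n'(X/Z)\end{pmatrix}.$$ 3. $(J_n)$ is a matrix divisibility sequence: if $m\mid n$, then $J_m$ is a right divisor of $J_n$ in $\mathrm{Mat}_2(S[X,Z])$, and for every commutative $S$-algebra $S'$ and every point $P\in\mathbb{A}^2(S')$, $J_m(P)$ is a right divisor of $J_n(P)$ in $\mathrm{Mat}_2(S')$. Consequently, if $m\mid n$, then $\det J_m\mid\det J_n$ in $S[X,Z]$ and $\det J_m(P)\mid\det J_n(P)$ in $S'$. 4. For all $n\ge 0$, in the field of fractions of $S[X,Z]$, $$\det J_n=n^2Z^{2(n^2-1)}\,W(\phi_n,\widetilde\psi_n)(X/Z),\qquad W(f,g)=f'g-fg'.$$ -/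

import Mathlib

namespace MatrixEDS

/-! ### Matrix divisibility sequences -/

/-- `M` right divides `N`: there is `Q` with `N = Q * M`. -/
def RightDvd {Γ : Type*} [Mul Γ] (a b : Γ) : Prop :=
  ∃ c : Γ, b = c * a

/-- A (right) divisibility sequence of `d × d` matrices over `R`, indexed by `Γ`: if `α` right
divides `β` in `Γ`, then `M α` right divides `M β` in the ring of `d × d` matrices over `R`. -/
def IsMatrixDvdSequence {Γ : Type*} [Mul Γ] {d : Type*} [Fintype d] {R : Type*} [CommRing R]
    (M : Γ → Matrix d d R) : Prop :=
  ∀ α β : Γ, RightDvd α β → RightDvd (M α) (M β)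

/-! ### Endomorphisms of affine space -/

/-- An endomorphism of affine `d`-space over `R`, given by its coordinate polynomials. -/
abbrev AffineEnd (d : Type*) (R : Type*) [CommRing R] : Type _ :=
  d → MvPolynomial d R

/-- The composite `F ∘ G`: substitute the coordinates of `G` into those of `F`. -/
noncomputable def AffineEnd.comp {d R : Type*} [CommRing R] (F G : AffineEnd d R) :
    AffineEnd d R :=
  fun i => MvPolynomial.bind₁ G (F i)

/-- The Jacobian matrix of an endomorphism of affine space: `(i, j)`-entry `∂ Fᵢ / ∂ xⱼ`. -/
noncomputable def AffineEnd.jacobian {d R : Type*} [CommRing R] (F : AffineEnd d R) :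
    Matrix d d (MvPolynomial d R) :=
  Matrix.of fun i j => MvPolynomial.pderiv j (F i)

/-! ### The universal short Weierstrass cubic and its division polynomials -/

/-- The ring `S = ℤ[A, B]`. -/
abbrev S : Type := MvPolynomial (Fin 2) ℤ

/-- The cubic `y² = x³ + A x + B` over `S = ℤ[A, B]`. -/
noncomputable def E : WeierstrassCurve S where
  a₁ := 0
  a₂ := 0
  a₃ := 0
  a₄ := MvPolynomial.X 0
  a₆ := MvPolynomial.X 1

/-- The division polynomial `φₙ`, as a polynomial in `x` alone. -/
noncomputable def phi (n : ℕ) : Polynomial S := E.Φ n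

/-- The square `ψₙ²` of the division polynomial `ψₙ`, as a polynomial in `x` alone. -/
noncomputable def psiSq (n : ℕ) : Polynomial S := E.ΨSq n

/-- On the curve, `phi n` is the classical bivariate division polynomial `φₙ`. -/
theorem mk_phi (n : ℕ) :
    WeierstrassCurve.Affine.CoordinateRing.mk E (Polynomial.C (phi n)) =
      WeierstrassCurve.Affine.CoordinateRing.mk E (E.φ n) :=
  (WeierstrassCurve.Affine.CoordinateRing.mk_φ E n).symm

/-- On the curve, `psiSq n` is the square of the classical bivariate division polynomial `ψₙ`. -/
theorem mk_psiSq (n : ℕ) :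
    WeierstrassCurve.Affine.CoordinateRing.mk E (Polynomial.C (psiSq n)) =
      WeierstrassCurve.Affine.CoordinateRing.mk E (E.ψ n) ^ 2 := by
  rw [WeierstrassCurve.Affine.CoordinateRing.mk_ψ,
    WeierstrassCurve.Affine.CoordinateRing.mk_Ψ_sq, psiSq]

/-- The map `[n] : 𝔸² → 𝔸²`, `(X, Z) ↦ (Z^(n²) φₙ(X/Z), Z^(n²) ψₙ²(X/Z))`. The coordinates on
`𝔸²` are `X = MvPolynomial.X 0` and `Z = MvPolynomial.X 1`, and `Polynomial.homogenize f N` is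
`∑_{k + l = N} f_k X^k Z^l`. -/
noncomputable def mulMap (n : ℕ) : AffineEnd (Fin 2) S :=
  ![(phi n).homogenize (n ^ 2), (psiSq n).homogenize (n ^ 2)]

/-- The Jacobian matrix `Jₙ` of `[n]`, with entries in `S[X, Z]`. -/
noncomputable def J (n : ℕ) : Matrix (Fin 2) (Fin 2) (MvPolynomial (Fin 2) S) :=
  (mulMap n).jacobian

/-- The Wronskian `W(f, g) = f' g - f g'`. (This is minus `Polynomial.wronskian f g`.) -/
noncomputable def W {R : Type*} [CommRing R] (f g : Polynomial R) : Polynomial R :=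
  Polynomial.derivative f * g - f * Polynomial.derivative g

/-! ### The field of fractions of `S[X, Z]`, where the quotient `X / Z` lives -/

/-- The field of rational functions in `X, Z` over `S`. -/
abbrev K : Type := FractionRing (MvPolynomial (Fin 2) S)

/-- The rational function `X`. -/
noncomputable def xK : K := algebraMap (MvPolynomial (Fin 2) S) K (MvPolynomial.X 0)

/-- The rational function `Z`. -/
noncomputable def zK : K := algebraMap (MvPolynomial (Fin 2) S) K (MvPolynomial.X 1)

/-- The rational function `f(X / Z)`, for a polynomial `f` in one variable over `S`. -/
noncomputable def atXZ (f : Polynomial S) : K := Polynomial.aeval (xK / zK) f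

end MatrixEDS

/-!
The heart of the matter is the identity `[m * n] = [m] ∘ [n]` of polynomial maps. By the chain rule
(`AffineEnd.jacobian_comp`) it gives `J (m * n) = (J m ∘ [n]) * J n`, which is a factorization with
polynomial entries; it specializes to every point and passes to determinants. The formulas for `J n`
and its determinant come from differentiating the homogenization of a polynomial in one variable.

The identity is checked in the field of rational functions in `X` and `Z`. With `t = X / Z` it says
that `ψₘₙ²(t) = ψₙ²(t) ^ (m ^ 2) * ψₘ²(tₙ)` for `tₙ = φₙ(t) / ψₙ²(t)`, and likewise for `φ`. Over an
algebraic closure, `t` is the `x`-coordinate of a point `P` of the curve at which no `ψₖ` with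
`k > 0` vanishes. Three facts about such a point are needed.

* `n • P` has coordinates `(φₙ / ψₙ², ψ₂ₙ / (2 ψₙ⁴))`, see `exists_smul_eq`. The recursions defining
  `ψ` are formulas for `x(mP) - x((m+1)P)` and `x((m-1)P) - x((m+1)P)`, and the induction only uses
  the two classical expressions for `x(Q - R) - x(Q + R)` and for
  `(x(Q + R) - r) (x(Q - R) - r)`, the latter being symmetric in `x(Q)`, `x(R)`, `r` after
  multiplication by `(x(Q) - x(R))²`.
* `ψ` satisfies the elliptic relation `ψ_{a+b} ψ_{a-b} = (x(bP) - x(aP)) ψ_a² ψ_b²`, see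
  `xMul_sub_xMul`; this is an induction on `b` by the same symmetry.
* Hence `m ↦ ψₘₙ(P) / ψₙ(P) ^ (m ^ 2)` satisfies the recursion of the division polynomials at `nP`.
  The initial values agree, so it is `ψₘ(nP)`, see `evalEval_ψ_mul`. This is an exact identity, with
  no constant or common factor left to determine.

Injectivity of `n ↦ [n]` is seen from degrees: the first coordinate of `[n]` is a nonzero form of
degree `n ^ 2`.
-/

namespace WeierstrassCurve.Affine

/-! ### Addition formulas on a short Weierstrass curve -/

section Field

variable {F : Type*} [Field F] (W : Affine F)

/-- The symmetric polynomial `F(p, q, r)` with `F(x(P), x(Q), r) =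
(x(P + Q) - r) (x(P - Q) - r) (x(P) - x(Q))²` for points `P ≠ ±Q` on `y² = x³ + a₄ x + a₆`. Being
symmetric in all three arguments, it lets the two summands and the point compared with them
trade places. -/
def sumDiffForm (p q r : F) : F :=
  (p * q) ^ 2 + (q * r) ^ 2 + (r * p) ^ 2 - 2 * p * q * r * (p + q + r)
    - 2 * W.a₄ * (p * q + q * r + r * p) + W.a₄ ^ 2 - 4 * W.a₆ * (p + q + r)

lemma sumDiffForm_swap (p q r : F) : W.sumDiffForm p q r = W.sumDiffForm r q p := by
  unfold sumDiffForm; ring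

lemma sumDiffForm_right_comm (p q r : F) : W.sumDiffForm p q r = W.sumDiffForm p r q := by
  unfold sumDiffForm; ring

variable {W} [W.IsShortNF] {x₁ y₁ x₂ y₂ : F}

lemma equation_iff_of_isShortNF {x y : F} :
    W.Equation x y ↔ y ^ 2 = x ^ 3 + W.a₄ * x + W.a₆ := by
  simp [equation_iff]

variable [DecidableEq F]

lemma exists_some_add_some {h₁ : W.Nonsingular x₁ y₁} {h₂ : W.Nonsingular x₂ y₂} (hx : x₁ ≠ x₂) :
    ∃ y₃ h₃, Point.some x₁ y₁ h₁ + Point.some x₂ y₂ h₂ =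
      Point.some (((y₁ - y₂) / (x₁ - x₂)) ^ 2 - x₁ - x₂) y₃ h₃ := by
  have key : W.addX x₁ x₂ (W.slope x₁ x₂ y₁ y₂) = ((y₁ - y₂) / (x₁ - x₂)) ^ 2 - x₁ - x₂ := by
    simp [addX, slope_of_X_ne hx]
  rw [Point.add_of_X_ne hx, ← key]
  exact ⟨_, _, rfl⟩

lemma exists_some_sub_some {h₁ : W.Nonsingular x₁ y₁} {h₂ : W.Nonsingular x₂ y₂} (hx : x₁ ≠ x₂) :
    ∃ y₃ h₃, Point.some x₁ y₁ h₁ - Point.some x₂ y₂ h₂ =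
      Point.some (((y₁ + y₂) / (x₁ - x₂)) ^ 2 - x₁ - x₂) y₃ h₃ := by
  have := exists_some_add_some (h₁ := h₁) (h₂ := (nonsingular_neg ..).mpr h₂) hx
  rw [sub_eq_add_neg (Point.some x₁ y₁ h₁), Point.neg_some]
  simpa [negY, sub_neg_eq_add] using this

variable {x₃ y₃ x₄ y₄ : F} {h₁ : W.Nonsingular x₁ y₁} {h₂ : W.Nonsingular x₂ y₂}
  {h₃ : W.Nonsingular x₃ y₃} {h₄ : W.Nonsingular x₄ y₄}

/-- The formula for `x(P - Q) - x(P + Q)`. With one of the points `P ± Q` known, it gives the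
`x`-coordinate of the other; with both known, it gives a `y`-coordinate. -/
lemma x_sub_sub_x_add (hx : x₁ ≠ x₂)
    (hadd : Point.some x₁ y₁ h₁ + Point.some x₂ y₂ h₂ = Point.some x₃ y₃ h₃)
    (hsub : Point.some x₁ y₁ h₁ - Point.some x₂ y₂ h₂ = Point.some x₄ y₄ h₄) :
    (x₄ - x₃) * (x₁ - x₂) ^ 2 = 4 * y₁ * y₂ := by
  obtain ⟨_, _, h⟩ := exists_some_add_some (h₁ := h₁) (h₂ := h₂) hx
  obtain ⟨_, _, h'⟩ := exists_some_sub_some (h₁ := h₁) (h₂ := h₂) hx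
  rw [hadd, Point.some.injEq] at h
  rw [hsub, Point.some.injEq] at h'
  have := sub_ne_zero.mpr hx
  rw [h.1, h'.1]
  field_simp
  ring

lemma x_add_sub_mul_x_sub_sub (hx : x₁ ≠ x₂)
    (hadd : Point.some x₁ y₁ h₁ + Point.some x₂ y₂ h₂ = Point.some x₃ y₃ h₃)
    (hsub : Point.some x₁ y₁ h₁ - Point.some x₂ y₂ h₂ = Point.some x₄ y₄ h₄) (r : F) :
    (x₃ - r) * (x₄ - r) * (x₁ - x₂) ^ 2 = W.sumDiffForm x₁ x₂ r := by
  obtain ⟨_, _, h⟩ := exists_some_add_some (h₁ := h₁) (h₂ := h₂) hx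
  obtain ⟨_, _, h'⟩ := exists_some_sub_some (h₁ := h₁) (h₂ := h₂) hx
  rw [hadd, Point.some.injEq] at h
  rw [hsub, Point.some.injEq] at h'
  have hne := sub_ne_zero.mpr hx
  have e₁ := equation_iff_of_isShortNF.mp h₁.1
  have e₂ := equation_iff_of_isShortNF.mp h₂.1
  have hsum : (x₃ + x₄) * (x₁ - x₂) ^ 2 =
      2 * ((x₁ * x₂ + W.a₄) * (x₁ + x₂) + 2 * W.a₆) := by
    rw [h.1, h'.1]
    field_simp
    linear_combination 2 * e₁ + 2 * e₂
  have hprod : x₃ * x₄ * (x₁ - x₂) ^ 2 = (x₁ * x₂ - W.a₄) ^ 2 - 4 * W.a₆ * (x₁ + x₂) := by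
    refine mul_right_cancel₀ (pow_ne_zero 2 hne) ?_
    rw [h.1, h'.1]
    have : (((y₁ - y₂) / (x₁ - x₂)) ^ 2 - x₁ - x₂) * (((y₁ + y₂) / (x₁ - x₂)) ^ 2 - x₁ - x₂)
        * (x₁ - x₂) ^ 2 * (x₁ - x₂) ^ 2 = (y₁ ^ 2 - y₂ ^ 2) ^ 2
          - 2 * (y₁ ^ 2 + y₂ ^ 2) * (x₁ + x₂) * (x₁ - x₂) ^ 2
          + (x₁ + x₂) ^ 2 * (x₁ - x₂) ^ 4 := by
      field_simp
      ring
    rw [this, e₁, e₂]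
    ring
  unfold sumDiffForm
  linear_combination hprod - r * hsum

lemma exists_two_zsmul_some (hy : 2 * y₁ ≠ 0) :
    ∃ h, (2 : ℤ) • Point.some x₁ y₁ h₁ = Point.some (((3 * x₁ ^ 2 + W.a₄) / (2 * y₁)) ^ 2 - 2 * x₁)
      ((3 * x₁ ^ 2 + W.a₄) / (2 * y₁) *
        (3 * x₁ - ((3 * x₁ ^ 2 + W.a₄) / (2 * y₁)) ^ 2) - y₁) h := by
  have hne : y₁ ≠ W.negY x₁ y₁ := by
    simp only [negY, a₁_of_isShortNF, a₃_of_isShortNF]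
    intro h
    exact hy (by linear_combination h)
  have hs : W.slope x₁ x₁ y₁ y₁ = (3 * x₁ ^ 2 + W.a₄) / (2 * y₁) := by
    rw [slope_of_Y_ne rfl hne]
    simp [negY, two_mul]
  have h1 : W.addX x₁ x₁ (W.slope x₁ x₁ y₁ y₁) =
      ((3 * x₁ ^ 2 + W.a₄) / (2 * y₁)) ^ 2 - 2 * x₁ := by
    rw [hs]; simp [addX]; ring
  have h2 : W.addY x₁ x₁ y₁ (W.slope x₁ x₁ y₁ y₁) = (3 * x₁ ^ 2 + W.a₄) / (2 * y₁) *
      (3 * x₁ - ((3 * x₁ ^ 2 + W.a₄) / (2 * y₁)) ^ 2) - y₁ := by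
    rw [hs]; simp [addY, negAddY, negY, addX]; ring
  rw [two_smul, Point.add_self_of_Y_ne hne, ← h1, ← h2]
  exact ⟨_, rfl⟩

/-- The tangent case `P = Q` of `x_add_sub_mul_x_sub_sub`. -/
lemma x_two_zsmul_sub (hy : 2 * y₁ ≠ 0)
    (hdbl : (2 : ℤ) • Point.some x₁ y₁ h₁ = Point.some x₃ y₃ h₃) (r : F) :
    (x₃ - r) * (2 * y₁) ^ 2 = W.sumDiffForm x₁ x₁ r := by
  obtain ⟨_, h⟩ := exists_two_zsmul_some (h₁ := h₁) hy
  rw [hdbl, Point.some.injEq] at h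
  have e₁ := equation_iff_of_isShortNF.mp h₁.1
  have : x₃ * (2 * y₁) ^ 2 = (3 * x₁ ^ 2 + W.a₄) ^ 2 - 2 * x₁ * (2 * y₁) ^ 2 := by
    rw [h.1, sub_mul, div_pow, div_mul_cancel₀ _ (pow_ne_zero 2 hy)]
  unfold sumDiffForm
  linear_combination this - 4 * (r + 2 * x₁) * e₁

end Field

open Polynomial
open scoped Polynomial.Bivariate

/-! ### Values of division polynomials at a point -/

section EvalEval

variable {R : Type*} [CommRing R] {W : WeierstrassCurve R} {x y : R}

lemma evalEval_eq_of_mk_eq (h : W.toAffine.Equation x y) {p q : R[X][Y]}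
    (hpq : CoordinateRing.mk W p = CoordinateRing.mk W q) : p.evalEval x y = q.evalEval x y := by
  obtain ⟨r, hr⟩ := AdjoinRoot.mk_eq_mk.mp hpq
  rw [← sub_eq_zero, ← evalEval_sub, hr, evalEval_mul, show W.toAffine.polynomial.evalEval x y = 0
    from h, zero_mul]

lemma evalEval_ψ_sq (h : W.toAffine.Equation x y) (n : ℤ) :
    (W.ψ n).evalEval x y ^ 2 = (W.ΨSq n).eval x := by
  rw [← evalEval_pow, evalEval_eq_of_mk_eq h (q := C (W.ΨSq n)), evalEval_C]
  rw [map_pow, CoordinateRing.mk_ψ, CoordinateRing.mk_Ψ_sq]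

lemma eval_Φ (h : W.toAffine.Equation x y) (n : ℤ) :
    (W.Φ n).eval x = x * (W.ψ n).evalEval x y ^ 2 -
      (W.ψ (n + 1)).evalEval x y * (W.ψ (n - 1)).evalEval x y := by
  rw [← evalEval_C x y, ← evalEval_eq_of_mk_eq h (CoordinateRing.mk_φ W n), WeierstrassCurve.φ]
  simp [evalEval_C]

lemma evalEval_ψ_odd (m : ℤ) : (W.ψ (2 * m + 1)).evalEval x y =
    (W.ψ (m + 2)).evalEval x y * (W.ψ m).evalEval x y ^ 3 -
      (W.ψ (m - 1)).evalEval x y * (W.ψ (m + 1)).evalEval x y ^ 3 := by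
  simp [ψ_odd]

lemma evalEval_ψ_even (m : ℤ) : (W.ψ (2 * m)).evalEval x y * W.ψ₂.evalEval x y =
    (W.ψ (m - 1)).evalEval x y ^ 2 * (W.ψ m).evalEval x y * (W.ψ (m + 2)).evalEval x y -
      (W.ψ (m - 2)).evalEval x y * (W.ψ m).evalEval x y * (W.ψ (m + 1)).evalEval x y ^ 2 := by
  rw [← evalEval_mul, ψ_even]
  simp

lemma evalEval_ψ₂_of_isShortNF [W.IsShortNF] : W.ψ₂.evalEval x y = 2 * y := by
  simp [ψ₂, evalEval_polynomialY]

lemma eval_Ψ₃_of_isShortNF [W.IsShortNF] :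
    W.Ψ₃.eval x = 3 * x ^ 4 + 6 * W.a₄ * x ^ 2 + 12 * W.a₆ * x - W.a₄ ^ 2 := by
  simp [Ψ₃, b₂, b₄, b₆, b₈]
  ring

lemma eval_preΨ₄_of_isShortNF [W.IsShortNF] :
    W.preΨ₄.eval x = 2 * (x ^ 6 + 5 * W.a₄ * x ^ 4 + 20 * W.a₆ * x ^ 3 - 5 * W.a₄ ^ 2 * x ^ 2
      - 4 * W.a₄ * W.a₆ * x - 8 * W.a₆ ^ 2 - W.a₄ ^ 3) := by
  simp [preΨ₄, b₂, b₄, b₆, b₈]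
  ring

end EvalEval

/-! ### Multiples of a point in terms of division polynomials -/

section Multiples

variable {F : Type*} [Field F] (W : WeierstrassCurve F) (x y : F)

/-- The expected `x`-coordinate `x - ψₖ₊₁ ψₖ₋₁ / ψₖ²` of `k • (x, y)`. -/
noncomputable def xMul (k : ℤ) : F :=
  x - (W.ψ (k + 1)).evalEval x y * (W.ψ (k - 1)).evalEval x y / (W.ψ k).evalEval x y ^ 2

/-- The expected `y`-coordinate `ψ₂ₖ / (2 ψₖ⁴)` of `k • (x, y)`, on a curve in short Weierstrass
form. -/
noncomputable def yMul (k : ℤ) : F :=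
  (W.ψ (2 * k)).evalEval x y / (2 * (W.ψ k).evalEval x y ^ 4)

variable {W x y}

@[simp] lemma xMul_one : xMul W x y 1 = x := by simp [xMul]

lemma xMul_sub (k : ℤ) : x - xMul W x y k =
    (W.ψ (k + 1)).evalEval x y * (W.ψ (k - 1)).evalEval x y / (W.ψ k).evalEval x y ^ 2 := by
  simp [xMul]

lemma eval_Φ_eq_xMul_mul (h : W.toAffine.Equation x y) {n : ℤ} (hn : (W.ψ n).evalEval x y ≠ 0) :
    (W.Φ n).eval x = xMul W x y n * (W.ΨSq n).eval x := by
  rw [eval_Φ h, ← evalEval_ψ_sq h, xMul]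
  field_simp

/-- The recursion for `ψ₂ₘ₊₁`, read as a difference of consecutive `x`-coordinates. -/
lemma xMul_sub_xMul_succ {m : ℤ} (h₀ : (W.ψ m).evalEval x y ≠ 0)
    (h₁ : (W.ψ (m + 1)).evalEval x y ≠ 0) :
    xMul W x y m - xMul W x y (m + 1) = (W.ψ (2 * m + 1)).evalEval x y /
      ((W.ψ m).evalEval x y ^ 2 * (W.ψ (m + 1)).evalEval x y ^ 2) := by
  rw [evalEval_ψ_odd]
  simp only [xMul, add_sub_cancel_right, add_assoc, one_add_one_eq_two]
  field_simp
  ring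

/-- The recursion for `ψ₂ₘ`, read as a difference of `x`-coordinates at distance two. -/
lemma xMul_pred_sub_xMul_succ {m : ℤ} (h₀ : (W.ψ (m - 1)).evalEval x y ≠ 0)
    (h₁ : (W.ψ (m + 1)).evalEval x y ≠ 0) :
    xMul W x y (m - 1) - xMul W x y (m + 1) =
      (W.ψ (2 * m)).evalEval x y * W.ψ₂.evalEval x y /
      ((W.ψ (m - 1)).evalEval x y ^ 2 * (W.ψ (m + 1)).evalEval x y ^ 2) := by
  rw [evalEval_ψ_even]
  simp only [xMul, add_sub_cancel_right, add_assoc, one_add_one_eq_two, sub_sub, sub_add_cancel]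
  field_simp
  ring

variable [DecidableEq F] [W.IsShortNF] {h : W.toAffine.Nonsingular x y}

/-- If three consecutive multiples have the expected `x`-coordinates, then the middle one has the
expected `y`-coordinate: `4 y(kP) y(P)` is determined by `x((k - 1)P) - x((k + 1)P)`. -/
lemma y_eq_yMul {k : ℤ} (h2 : (2 : F) ≠ 0) (hy : y ≠ 0) (h₀ : (W.ψ k).evalEval x y ≠ 0)
    (h₁ : (W.ψ (k + 1)).evalEval x y ≠ 0) (hp : (W.ψ (k - 1)).evalEval x y ≠ 0)
    {y₀ y₁ y₂ : F} {n₀ n₁ n₂}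
    (e₀ : k • Point.some x y h = Point.some (xMul W x y k) y₀ n₀)
    (e₁ : (k + 1) • Point.some x y h = Point.some (xMul W x y (k + 1)) y₁ n₁)
    (e₂ : (k - 1) • Point.some x y h = Point.some (xMul W x y (k - 1)) y₂ n₂) :
    y₀ = yMul W x y k := by
  have hx := xMul_sub (W := W) (x := x) (y := y) k
  have hne : xMul W x y k ≠ x := by
    intro hxx
    rw [hxx, sub_self, eq_comm, div_eq_zero_iff] at hx
    simp_all
  rw [add_smul, one_smul, e₀] at e₁
  rw [sub_smul, one_smul, e₀] at e₂
  have := x_sub_sub_x_add hne e₁ e₂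
  rw [xMul_pred_sub_xMul_succ hp h₁, evalEval_ψ₂_of_isShortNF,
    ← neg_sub x, hx] at this
  rw [yMul]
  field_simp at this ⊢
  exact mul_left_cancel₀ h2 (by linear_combination -this)


/-- The multiple `(2m + 1)P` is the sum of `(m + 1)P` and `mP`, whose difference is `P`. -/
lemma exists_smul_odd (h2 : (2 : F) ≠ 0) {m : ℤ} (h₀ : (W.ψ m).evalEval x y ≠ 0)
    (h₁ : (W.ψ (m + 1)).evalEval x y ≠ 0) (hm : (W.ψ (2 * m + 1)).evalEval x y ≠ 0) {n₀ n₁}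
    (e₀ : m • Point.some x y h = Point.some (xMul W x y m) (yMul W x y m) n₀)
    (e₁ : (m + 1) • Point.some x y h =
      Point.some (xMul W x y (m + 1)) (yMul W x y (m + 1)) n₁) :
    ∃ y' h', (2 * m + 1) • Point.some x y h = Point.some (xMul W x y (2 * m + 1)) y' h' := by
  have hx := xMul_sub_xMul_succ h₀ h₁
  have hne : xMul W x y (m + 1) ≠ xMul W x y m := by
    intro hxx
    rw [hxx, sub_self, eq_comm, div_eq_zero_iff] at hx
    simp_all
  obtain ⟨y₃, h₃, hadd⟩ := exists_some_add_some (h₁ := n₁) (h₂ := n₀) hne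
  have hsub : Point.some _ _ n₁ - Point.some _ _ n₀ = Point.some x y h := by
    rw [← e₀, ← e₁, add_smul, one_smul, add_sub_cancel_left]
  have key := x_sub_sub_x_add hne hadd hsub
  generalize ((yMul W x y (m + 1) - yMul W x y m) / _) ^ 2 - _ - _ = x₃ at *
  have hx₃ : x₃ = xMul W x y (2 * m + 1) := by
    rw [← neg_sub (xMul W x y m), hx, yMul, yMul, mul_add, mul_one] at key
    rw [xMul, add_sub_cancel_right, add_assoc (2 * m), one_add_one_eq_two]
    field_simp at key ⊢
    refine mul_left_cancel₀ (mul_ne_zero h2 h2) ?_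
    linear_combination -key
  subst hx₃
  refine ⟨y₃, h₃, ?_⟩
  rw [← hadd, ← e₀, ← e₁, ← add_smul]
  congr 1
  ring

/-- The tangent construction at `mP` and the chord through `mP` and `P` are related by the symmetry
of `sumDiffForm`, for `x = x(P)`:
`(x(2mP) - x) (2 y(mP))² = (x((m+1)P) - x(mP)) (x((m-1)P) - x(mP)) (x(mP) - x)²`. -/
lemma exists_smul_even (h2 : (2 : F) ≠ 0) {m : ℤ} (h₀ : (W.ψ m).evalEval x y ≠ 0)
    (h₁ : (W.ψ (m + 1)).evalEval x y ≠ 0) (hp : (W.ψ (m - 1)).evalEval x y ≠ 0)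
    (hm : (W.ψ (2 * m)).evalEval x y ≠ 0) {y₁ y₂ : F} {n₀ n₁ n₂}
    (e₀ : m • Point.some x y h = Point.some (xMul W x y m) (yMul W x y m) n₀)
    (e₁ : (m + 1) • Point.some x y h = Point.some (xMul W x y (m + 1)) y₁ n₁)
    (e₂ : (m - 1) • Point.some x y h = Point.some (xMul W x y (m - 1)) y₂ n₂) :
    ∃ y' h', (2 * m) • Point.some x y h = Point.some (xMul W x y (2 * m)) y' h' := by
  have hx := xMul_sub (W := W) (x := x) (y := y) m
  have hne : xMul W x y m ≠ x := by
    intro hxx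
    rw [hxx, sub_self, eq_comm, div_eq_zero_iff] at hx
    simp_all
  have hy0 : 2 * yMul W x y m ≠ 0 := by
    simp [yMul, h2, h₀, hm]
  obtain ⟨h₃, hdbl⟩ := exists_two_zsmul_some (h₁ := n₀) hy0
  have key := x_two_zsmul_sub hy0 hdbl x
  generalize (_ / (2 * yMul W x y m)) ^ 2 - _ = x₃ at *
  rw [add_smul, one_smul, e₀] at e₁
  rw [sub_smul, one_smul, e₀] at e₂
  rw [sumDiffForm_right_comm, ← x_add_sub_mul_x_sub_sub hne e₁ e₂] at key
  have d₁ := xMul_sub_xMul_succ h₀ h₁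
  have d₂ := xMul_sub_xMul_succ hp (by simpa using h₀)
  rw [sub_add_cancel] at d₂
  rw [d₂, ← neg_sub x x₃, ← neg_sub x (xMul W x y m), ← neg_sub (xMul W x y m), d₁, hx, yMul,
    show 2 * (m - 1) + 1 = 2 * m - 1 by ring] at key
  have hx₃ : x₃ = xMul W x y (2 * m) := by
    rw [xMul]
    field_simp at key ⊢
    linear_combination key
  subst hx₃
  rw [mul_smul, e₀, hdbl]
  exact ⟨_, _, rfl⟩

lemma exists_two_smul (hy : 2 * y ≠ 0) :
    ∃ h', (2 : ℤ) • Point.some x y h = Point.some (xMul W x y 2) (yMul W x y 2) h' := by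
  obtain ⟨h', e⟩ := exists_two_zsmul_some (h₁ := h) hy
  have e₁ := equation_iff_of_isShortNF.mp h.1
  have h2 : (2 : F) ≠ 0 := left_ne_zero_of_mul hy
  have hy' : y ≠ 0 := right_ne_zero_of_mul hy
  have hX : xMul W x y 2 = ((3 * x ^ 2 + W.a₄) / (2 * y)) ^ 2 - 2 * x := by
    simp only [xMul, Int.reduceAdd, Int.reduceSub, ψ_three, ψ_one, ψ_two, evalEval_C,
      evalEval_one, evalEval_ψ₂_of_isShortNF, eval_Ψ₃_of_isShortNF]
    field_simp
    linear_combination 12 * x * e₁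
  have hY : yMul W x y 2 = (3 * x ^ 2 + W.a₄) / (2 * y) *
      (3 * x - ((3 * x ^ 2 + W.a₄) / (2 * y)) ^ 2) - y := by
    simp only [yMul, Int.reduceMul, ψ_four, ψ_two, evalEval_C, evalEval_mul,
      evalEval_ψ₂_of_isShortNF, eval_preΨ₄_of_isShortNF]
    field_simp
    linear_combination (8 * y ^ 2 + 8 * (x ^ 3 + W.a₄ * x + W.a₆) -
      12 * x * (3 * x ^ 2 + W.a₄)) * e₁
  rw [hX, hY]
  exact ⟨h', e⟩

/-- If no `ψₖ` with `k > 0` vanishes at `P = (x, y)`, then `n • P` is an affine point with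
coordinates `xMul` and `yMul`. The induction on `n` follows the recursion of `ψ`: the `x`-coordinate at `2m`
or `2m + 1` comes from the coordinates near `m`, and each `y`-coordinate from the three
neighbouring `x`-coordinates. -/
theorem exists_smul_eq (hψ : ∀ k : ℤ, 0 < k → (W.ψ k).evalEval x y ≠ 0) {n : ℤ} (hn : 0 < n) :
    ∃ h', n • Point.some x y h = Point.some (xMul W x y n) (yMul W x y n) h' := by
  have hy : 2 * y ≠ 0 := by
    simpa [evalEval_ψ₂_of_isShortNF] using hψ 2 two_pos
  have h2 : (2 : F) ≠ 0 := left_ne_zero_of_mul hy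
  have hy' : y ≠ 0 := right_ne_zero_of_mul hy
  have Y1 : ∃ h', (1 : ℤ) • Point.some x y h = Point.some (xMul W x y 1) (yMul W x y 1) h' := by
    have : yMul W x y 1 = y := by
      simp [yMul, evalEval_ψ₂_of_isShortNF, h2]
    rw [this, xMul_one, one_smul]
    exact ⟨h, rfl⟩
  have Y2 := exists_two_smul (h := h) hy
  let HX (k : ℤ) : Prop := ∃ y' h', k • Point.some x y h = Point.some (xMul W x y k) y' h'
  have toY {k : ℤ} (hk : 1 < k) (hp : HX (k - 1)) (h₀ : HX k) (h₁ : HX (k + 1)) :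
      ∃ h', k • Point.some x y h = Point.some (xMul W x y k) (yMul W x y k) h' := by
    obtain ⟨y₀, n₀, e₀⟩ := h₀
    obtain ⟨_, _, e₁⟩ := h₁
    obtain ⟨_, _, e₂⟩ := hp
    obtain rfl := y_eq_yMul h2 hy' (hψ k (by omega)) (hψ (k + 1) (by omega))
      (hψ (k - 1) (by omega)) e₀ e₁ e₂
    exact ⟨n₀, e₀⟩
  have X1 : HX 1 := ⟨_, Y1⟩
  have X2 : HX 2 := ⟨_, Y2⟩
  -- `3P` is treated apart: `y(2P)` is computed directly, since `y_eq_yMul` would need `x(3P)`.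
  have X3 : HX 3 := by
    obtain ⟨_, e₀⟩ := Y1
    obtain ⟨_, e₁⟩ := Y2
    exact exists_smul_odd (m := 1) h2 (hψ 1 (by omega)) (hψ 2 (by omega)) (hψ 3 (by omega)) e₀ e₁
  have even {m : ℤ} (hm : 1 < m) (hp : HX (m - 1)) (h₀ : HX m) (h₁ : HX (m + 1)) :
      HX (2 * m) := by
    obtain ⟨_, e₀⟩ := toY hm hp h₀ h₁
    obtain ⟨_, _, e₁⟩ := h₁
    obtain ⟨_, _, e₂⟩ := hp
    exact exists_smul_even h2 (hψ m (by omega)) (hψ (m + 1) (by omega)) (hψ (m - 1) (by omega))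
      (hψ (2 * m) (by omega))
      e₀ e₁ e₂
  have odd {m : ℤ} (hm : 1 < m) (hp : HX (m - 1)) (h₀ : HX m) (h₁ : HX (m + 1))
      (h₂ : HX (m + 2)) : HX (2 * m + 1) := by
    obtain ⟨_, e₀⟩ := toY hm hp h₀ h₁
    obtain ⟨_, e₁⟩ := toY (k := m + 1) (by omega) (by simpa) h₁ (by convert h₂ using 1; ring)
    exact exists_smul_odd h2 (hψ m (by omega)) (hψ (m + 1) (by omega))
      (hψ (2 * m + 1) (by omega)) e₀ e₁
  have cast {a : ℕ} {b : ℤ} (ha : a = 0 ∨ HX a) (hb : 0 < b) (hab : (a : ℤ) = b) : HX b := by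
    subst hab
    exact ha.resolve_left (by omega)
  have X (k : ℕ) : k = 0 ∨ HX k := by
    induction k using normEDSRec with
    | zero => exact .inl rfl
    | one => exact .inr X1
    | two => exact .inr X2
    | three => exact .inr X3
    | four => exact .inr (even (m := 2) (by omega) X1 X2 X3)
    | even m _ h₂ h₃ h₄ _ =>
      exact .inr (even (m := (m + 3 : ℕ)) (by omega) (cast h₂ (by omega) (by omega))
        (cast h₃ (by omega) rfl) (cast h₄ (by omega) (by omega)))
    | odd m h₁ h₂ h₃ h₄ =>
      exact .inr (odd (m := (m + 2 : ℕ)) (by omega) (cast h₁ (by omega) (by omega))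
        (cast h₂ (by omega) rfl) (cast h₃ (by omega) (by omega))
        (cast h₄ (by omega) (by omega)))
  have X' {k : ℤ} (hk : 0 < k) : HX k := by
    lift k to ℕ using hk.le
    exact (X k).resolve_left (by omega)
  obtain rfl | hn1 := (show 1 ≤ n from hn).eq_or_lt
  · exact Y1
  · exact toY hn1 (X' (by omega)) (X' (by omega)) (X' (by omega))

end Multiples

/-! ### The composition law for division polynomials at a point -/

section Composition

variable {F : Type*} [Field F] {W : WeierstrassCurve F} [W.IsShortNF] {x y : F}

/-- The elliptic relation `ψ_{a+b} ψ_{a-b} = (x(bP) - x(aP)) ψ_a² ψ_b²`. Both sides satisfy the same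
recursion in `b`, the differences of `x`-coordinates because `sumDiffForm` is symmetric. -/
lemma xMul_sub_xMul (h : W.toAffine.Nonsingular x y)
    (hψ : ∀ k : ℤ, 0 < k → (W.ψ k).evalEval x y ≠ 0) {a b : ℤ} (hb : 0 < b) (hab : b < a) :
    xMul W x y b - xMul W x y a = (W.ψ (a + b)).evalEval x y * (W.ψ (a - b)).evalEval x y /
      ((W.ψ a).evalEval x y ^ 2 * (W.ψ b).evalEval x y ^ 2) := by
  classical
  have key {a : ℤ} (ha : 1 < a) (r : F) :
      (xMul W x y (a + 1) - r) * (xMul W x y (a - 1) - r) * (x - xMul W x y a) ^ 2 =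
        W.toAffine.sumDiffForm (xMul W x y a) x r := by
    obtain ⟨_, e₀⟩ := exists_smul_eq (h := h) hψ (n := a) (by omega)
    obtain ⟨_, e₁⟩ := exists_smul_eq (h := h) hψ (n := a + 1) (by omega)
    obtain ⟨_, e₂⟩ := exists_smul_eq (h := h) hψ (n := a - 1) (by omega)
    have hne : xMul W x y a ≠ x := by
      have := xMul_sub (W := W) (x := x) (y := y) a
      intro hxx
      rw [hxx, sub_self, eq_comm, div_eq_zero_iff] at this
      simp [hψ a (by omega), hψ (a + 1) (by omega), hψ (a - 1) (by omega)] at this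
    rw [add_smul, one_smul, e₀] at e₁
    rw [sub_smul, one_smul, e₀] at e₂
    rw [← x_add_sub_mul_x_sub_sub hne e₁ e₂]
    ring
  have step (b : ℕ) : ∀ a : ℤ, (b + 1 : ℕ) < a → xMul W x y (b + 1 : ℕ) - xMul W x y a =
      (W.ψ (a + (b + 1 : ℕ))).evalEval x y * (W.ψ (a - (b + 1 : ℕ))).evalEval x y /
        ((W.ψ a).evalEval x y ^ 2 * (W.ψ (b + 1 : ℕ)).evalEval x y ^ 2) := by
    induction b using Nat.twoStepInduction with
    | zero =>
      intro a ha
      simp [xMul_sub]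
    | one =>
      intro a ha
      push_cast at ha ⊢
      have hψ₂ := hψ 2 (by omega)
      have hy : 2 * y ≠ 0 := by simpa [evalEval_ψ₂_of_isShortNF] using hψ₂
      obtain ⟨_, e⟩ := exists_two_smul (h := h) hy
      have e₂ := x_two_zsmul_sub hy e (xMul W x y a)
      -- Here `x((b - 1)P)` would be at infinity, so the duplication formula for `P` takes the place
      -- of the chord through `bP` and `P`.
      rw [sumDiffForm_swap, ← key (by omega), ← neg_sub x, ← neg_sub x (xMul W x y (a - 1)),
        xMul_sub, xMul_sub, xMul_sub, add_sub_cancel_right, sub_add_cancel, add_assoc, sub_sub,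
        one_add_one_eq_two] at e₂
      rw [ψ_two, evalEval_ψ₂_of_isShortNF]
      have h₁ := hψ (a + 1) (by omega)
      have hp := hψ (a - 1) (by omega)
      have h₀ := hψ a (by omega)
      generalize xMul W x y 2 - xMul W x y a = d at *
      generalize 2 * y = t at *
      field_simp at e₂ ⊢
      linear_combination e₂
    | more b ih₀ ih₁ =>
      intro a ha
      obtain ⟨c, hc⟩ : ∃ c : ℤ, c = (b + 2 : ℕ) := ⟨_, rfl⟩
      rw [show ((b + 2 + 1 : ℕ) : ℤ) = c + 1 by omega] at ha ⊢
      rw [show ((b + 1 + 1 : ℕ) : ℤ) = c by omega] at ih₁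
      rw [show ((b + 1 : ℕ) : ℤ) = c - 1 by omega] at ih₀
      have e := key (a := c) (by omega) (xMul W x y a)
      rw [sumDiffForm_swap, ← key (by omega), ih₀ a (by omega), xMul_sub, xMul_sub,
        ← neg_sub _ (xMul W x y (a + 1)), ← neg_sub _ (xMul W x y (a - 1)),
        ih₁ (a + 1) (by omega), ih₁ (a - 1) (by omega),
        show a + 1 + c = a + c + 1 by ring, show a - 1 + c = a + c - 1 by ring,
        show a + 1 - c = a - c + 1 by ring, show a - 1 - c = a - c - 1 by ring,
        show a + (c - 1) = a + c - 1 by ring, show a - (c - 1) = a - c + 1 by ring] at e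
      rw [show a + (c + 1) = a + c + 1 by ring, show a - (c + 1) = a - c - 1 by ring]
      have := hψ (a + 1) (by omega)
      have := hψ (a - 1) (by omega)
      have := hψ a (by omega)
      have := hψ c (by omega)
      have := hψ (c + 1) (by omega)
      have := hψ (c - 1) (by omega)
      have := hψ (a - c + 1) (by omega)
      have := hψ (a + c - 1) (by omega)
      generalize xMul W x y (c + 1) - xMul W x y a = d at *
      field_simp at e ⊢
      linear_combination e
  have := step (b.toNat - 1) a (by omega)
  rwa [show ((b.toNat - 1 + 1 : ℕ) : ℤ) = b by omega] at this

/-- The even recursion for the sequence `m ↦ ψ (m * n)`, up to powers of `ψ n`. -/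
lemma ψ_even_mul (h : W.toAffine.Nonsingular x y)
    (hψ : ∀ k : ℤ, 0 < k → (W.ψ k).evalEval x y ≠ 0) {m n : ℤ} (hn : 0 < n) (hm : 2 < m) :
    (W.ψ (2 * m * n)).evalEval x y * (W.ψ (2 * n)).evalEval x y * (W.ψ n).evalEval x y ^ 2 =
      (W.ψ ((m - 1) * n)).evalEval x y ^ 2 * (W.ψ (m * n)).evalEval x y *
        (W.ψ ((m + 2) * n)).evalEval x y -
      (W.ψ ((m - 2) * n)).evalEval x y * (W.ψ (m * n)).evalEval x y *
        (W.ψ ((m + 1) * n)).evalEval x y ^ 2 := by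
  have d₁ := xMul_sub_xMul h hψ (a := (m + 1) * n) (b := (m - 1) * n) (by nlinarith) (by nlinarith)
  have d₂ := xMul_sub_xMul h hψ (a := (m + 1) * n) (b := n) hn (by nlinarith)
  have d₃ := xMul_sub_xMul h hψ (a := (m - 1) * n) (b := n) hn (by nlinarith)
  rw [show (m + 1) * n + (m - 1) * n = 2 * m * n by ring,
    show (m + 1) * n - (m - 1) * n = 2 * n by ring] at d₁
  rw [show (m + 1) * n + n = (m + 2) * n by ring, show (m + 1) * n - n = m * n by ring] at d₂
  rw [show (m - 1) * n + n = m * n by ring, show (m - 1) * n - n = (m - 2) * n by ring] at d₃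
  have e : xMul W x y ((m - 1) * n) - xMul W x y ((m + 1) * n) =
      xMul W x y n - xMul W x y ((m + 1) * n) - (xMul W x y n - xMul W x y ((m - 1) * n)) := by
    ring
  rw [d₁, d₂, d₃] at e
  have := hψ n hn
  have := hψ ((m + 1) * n) (by nlinarith)
  have := hψ ((m - 1) * n) (by nlinarith)
  field_simp at e
  linear_combination e

/-- The odd recursion for the sequence `m ↦ ψ (m * n)`, up to powers of `ψ n`. -/
lemma ψ_odd_mul (h : W.toAffine.Nonsingular x y)
    (hψ : ∀ k : ℤ, 0 < k → (W.ψ k).evalEval x y ≠ 0) {m n : ℤ} (hn : 0 < n) (hm : 1 < m) :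
    (W.ψ ((2 * m + 1) * n)).evalEval x y * (W.ψ n).evalEval x y ^ 3 =
      (W.ψ ((m + 2) * n)).evalEval x y * (W.ψ (m * n)).evalEval x y ^ 3 -
      (W.ψ ((m - 1) * n)).evalEval x y * (W.ψ ((m + 1) * n)).evalEval x y ^ 3 := by
  have d₁ := xMul_sub_xMul h hψ (a := (m + 1) * n) (b := m * n) (by nlinarith) (by nlinarith)
  have d₂ := xMul_sub_xMul h hψ (a := (m + 1) * n) (b := n) hn (by nlinarith)
  have d₃ := xMul_sub_xMul h hψ (a := m * n) (b := n) hn (by nlinarith)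
  rw [show (m + 1) * n + m * n = (2 * m + 1) * n by ring,
    show (m + 1) * n - m * n = n by ring] at d₁
  rw [show (m + 1) * n + n = (m + 2) * n by ring, show (m + 1) * n - n = m * n by ring] at d₂
  rw [show m * n + n = (m + 1) * n by ring, show m * n - n = (m - 1) * n by ring] at d₃
  have e : xMul W x y (m * n) - xMul W x y ((m + 1) * n) =
      xMul W x y n - xMul W x y ((m + 1) * n) - (xMul W x y n - xMul W x y (m * n)) := by
    ring
  rw [d₁, d₂, d₃] at e
  have := hψ n hn
  have := hψ ((m + 1) * n) (by nlinarith)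
  have := hψ (m * n) (by nlinarith)
  field_simp at e
  linear_combination e

/-- `ψₘ(nP) ψₙ(P)^(m²) = ψₘₙ(P)`: as sequences in `m`, the values `ψₘₙ(P) / ψₙ(P)^(m²)` satisfy the
recursion of the division polynomials at `nP`, and the initial values agree by the duplication
formula at `nP`. -/
theorem evalEval_ψ_mul (h : W.toAffine.Nonsingular x y)
    (hψ : ∀ k : ℤ, 0 < k → (W.ψ k).evalEval x y ≠ 0) {n : ℤ} (hn : 0 < n) (m : ℕ) :
    (W.ψ m).evalEval (xMul W x y n) (yMul W x y n) * (W.ψ n).evalEval x y ^ m ^ 2 =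
      (W.ψ (m * n)).evalEval x y := by
  classical
  have hψ₂ := hψ 2 (by omega)
  have h2 : (2 : F) ≠ 0 := by
    rw [ψ_two, evalEval_ψ₂_of_isShortNF] at hψ₂
    exact left_ne_zero_of_mul hψ₂
  obtain ⟨hQ, e⟩ := exists_smul_eq (h := h) hψ hn
  obtain ⟨_, e₂⟩ := exists_smul_eq (h := h) hψ (n := 2 * n) (by omega)
  have hu := hψ n hn
  have h2n := hψ (2 * n) (by omega)
  have hy : 2 * yMul W x y n ≠ 0 := by
    simp [yMul, h2, hu, h2n]
  have v₂ : 2 * yMul W x y n * (W.ψ n).evalEval x y ^ 4 = (W.ψ (2 * n)).evalEval x y := by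
    rw [yMul]
    field_simp
  obtain ⟨_, e'⟩ := exists_two_smul (h := hQ) hy
  -- Both sides of `2 • nP = (2n) • P` are known, the left one in terms of the coordinates of `nP`.
  rw [mul_smul, e, e', Point.some.injEq] at e₂
  obtain ⟨eX, eY⟩ := e₂
  have d := xMul_sub_xMul h hψ (a := 2 * n) hn (by omega)
  rw [← eX, show 2 * n + n = 3 * n by ring, show 2 * n - n = n by ring] at d
  rw [yMul, yMul.eq_def W x y (2 * n), show 2 * (2 * n) = 4 * n by ring, ← v₂] at eY
  have hev := fun k : ℤ ↦ evalEval_ψ_even (W := W) (x := xMul W x y n) (y := yMul W x y n) k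
  have hod := fun k : ℤ ↦ evalEval_ψ_odd (W := W) (x := xMul W x y n) (y := yMul W x y n) k
  simp only [evalEval_ψ₂_of_isShortNF] at hev
  generalize xMul W x y n = a at *
  generalize yMul W x y n = b at *
  have hb := right_ne_zero_of_mul hy
  induction m using normEDSRec with
  | zero => simp
  | one => simp
  | two =>
    simp only [Nat.cast_ofNat, ψ_two, evalEval_ψ₂_of_isShortNF, ← v₂]
    norm_num
  | three =>
    rw [xMul_sub, ← v₂] at d
    simp only [Int.reduceAdd, Int.reduceSub, ψ_one, evalEval_one, ψ_two,
      evalEval_ψ₂_of_isShortNF, mul_one] at d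
    field_simp at d
    push_cast
    linear_combination d
  | four =>
    simp only [Int.reduceMul, ψ_two, evalEval_ψ₂_of_isShortNF] at eY
    field_simp at eY
    push_cast
    linear_combination eY
  | even m h₁ h₂ h₃ h₄ h₅ =>
    have r := ψ_even_mul h hψ (m := m + 3) (n := n) hn (by omega)
    have s := hev (m + 3)
    rw [← v₂] at r
    push_cast at *
    rw [show (m : ℤ) + 3 - 1 = m + 2 by ring, show (m : ℤ) + 3 + 2 = m + 5 by ring,
      show (m : ℤ) + 3 - 2 = m + 1 by ring, show (m : ℤ) + 3 + 1 = m + 4 by ring] at r s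
    rw [← h₁, ← h₂, ← h₃, ← h₄, ← h₅] at r
    have hu6 := mul_ne_zero hy (pow_ne_zero 6 hu)
    refine mul_right_cancel₀ hu6 ?_
    linear_combination (W.ψ n).evalEval x y ^ ((2 * (m + 3)) ^ 2 + 6) * s - r
  | odd m h₁ h₂ h₃ h₄ =>
    have r := ψ_odd_mul h hψ (m := m + 2) (n := n) hn (by omega)
    have s := hod (m + 2)
    push_cast at *
    rw [show (m : ℤ) + 2 - 1 = m + 1 by ring, show (m : ℤ) + 2 + 2 = m + 4 by ring,
      show (m : ℤ) + 2 + 1 = m + 3 by ring] at r s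
    rw [← h₁, ← h₂, ← h₃, ← h₄] at r
    refine mul_right_cancel₀ (pow_ne_zero 3 hu) ?_
    linear_combination (W.ψ n).evalEval x y ^ ((2 * (m + 2) + 1) ^ 2 + 3) * s - r

lemma eval_ΨSq_mul (h : W.toAffine.Nonsingular x y)
    (hψ : ∀ k : ℤ, 0 < k → (W.ψ k).evalEval x y ≠ 0) {n : ℤ} (hn : 0 < n) (m : ℕ) :
    (W.ΨSq m).eval ((W.Φ n).eval x / (W.ΨSq n).eval x) * (W.ΨSq n).eval x ^ m ^ 2 =
      (W.ΨSq (m * n)).eval x := by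
  classical
  obtain ⟨hQ, -⟩ := exists_smul_eq (h := h) hψ hn
  have hu := hψ n hn
  rw [eval_Φ_eq_xMul_mul h.1 hu, mul_div_cancel_right₀ _ (by simpa [← evalEval_ψ_sq h.1]),
    ← evalEval_ψ_sq hQ.1, ← evalEval_ψ_sq h.1, ← evalEval_ψ_sq h.1, ← evalEval_ψ_mul h hψ hn]
  ring

lemma eval_Φ_mul (h : W.toAffine.Nonsingular x y)
    (hψ : ∀ k : ℤ, 0 < k → (W.ψ k).evalEval x y ≠ 0) {n : ℤ} (hn : 0 < n) (m : ℕ) :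
    (W.Φ m).eval ((W.Φ n).eval x / (W.ΨSq n).eval x) * (W.ΨSq n).eval x ^ m ^ 2 =
      (W.Φ (m * n)).eval x := by
  classical
  rcases m with _ | m
  · simp
  obtain ⟨hQ, -⟩ := exists_smul_eq (h := h) hψ hn
  have hu := hψ n hn
  have hmn : 0 < ((m + 1 : ℕ) : ℤ) * n := by positivity
  have d : xMul W x y n - xMul W x y ((m + 1 : ℕ) * n) =
      (W.ψ ((m + 2 : ℕ) * n)).evalEval x y * (W.ψ (m * n)).evalEval x y /
      ((W.ψ ((m + 1 : ℕ) * n)).evalEval x y ^ 2 * (W.ψ n).evalEval x y ^ 2) := by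
    rcases m with _ | m
    · simp
    rw [xMul_sub_xMul h hψ hn (by push_cast; nlinarith)]
    congr 4 <;> push_cast <;> ring
  rw [eval_Φ_eq_xMul_mul h.1 (hψ _ hmn), eval_Φ_eq_xMul_mul h.1 hu,
    mul_div_cancel_right₀ _ (by simpa [← evalEval_ψ_sq h.1]), eval_Φ hQ.1,
    ← evalEval_ψ_sq h.1, ← evalEval_ψ_sq h.1]
  have e₀ := evalEval_ψ_mul h hψ hn m
  have e₁ := evalEval_ψ_mul h hψ hn (m + 1)
  have e₂ := evalEval_ψ_mul h hψ hn (m + 2)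
  rw [eq_div_iff (mul_ne_zero (pow_ne_zero 2 (hψ _ hmn)) (pow_ne_zero 2 hu)),
    ← e₀, ← e₁, ← e₂] at d
  rw [← e₁, show ((m + 1 : ℕ) : ℤ) + 1 = (m + 2 : ℕ) by push_cast; ring,
    show ((m + 1 : ℕ) : ℤ) - 1 = m by push_cast; ring]
  refine mul_right_cancel₀ (pow_ne_zero 2 hu) ?_
  linear_combination d

end Composition

/-! ### The composition law on the line -/

section Generic

instance {R S : Type*} [CommRing R] [CommRing S] (f : R →+* S) (W : WeierstrassCurve R)
    [W.IsShortNF] : (W.map f).IsShortNF where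
  a₁ := by simp
  a₂ := by simp
  a₃ := by simp

variable {F : Type*} [Field F] {W : WeierstrassCurve F} [W.IsShortNF] {x : F}

lemma exists_nonsingular [IsAlgClosed F] (h : ∀ k : ℤ, 0 < k → (W.ΨSq k).eval x ≠ 0) :
    ∃ y, W.toAffine.Nonsingular x y ∧ ∀ k : ℤ, 0 < k → (W.ψ k).evalEval x y ≠ 0 := by
  obtain ⟨y, hy⟩ := IsAlgClosed.exists_pow_nat_eq (x ^ 3 + W.a₄ * x + W.a₆) two_pos
  have heq : W.toAffine.Equation x y := equation_iff_of_isShortNF.mpr hy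
  have hψ (k : ℤ) (hk : 0 < k) : (W.ψ k).evalEval x y ≠ 0 := by
    have := h k hk
    rw [← evalEval_ψ_sq heq] at this
    exact pow_ne_zero_iff two_ne_zero |>.mp this
  refine ⟨y, (nonsingular_iff ..).mpr ⟨heq, .inr fun hne ↦ hψ 2 two_pos ?_⟩, hψ⟩
  rw [ψ_two, evalEval_ψ₂_of_isShortNF]
  simp only [a₁_of_isShortNF, a₃_of_isShortNF] at hne
  linear_combination hne

/-- The composition law in terms of `x` alone. The missing `y`-coordinate is found over an algebraic
closure. -/
theorem eval_comp (h : ∀ k : ℤ, 0 < k → (W.ΨSq k).eval x ≠ 0) {n : ℤ} (hn : 0 < n) (m : ℕ) :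
    (W.Φ m).eval ((W.Φ n).eval x / (W.ΨSq n).eval x) * (W.ΨSq n).eval x ^ m ^ 2 =
        (W.Φ (m * n)).eval x ∧
      (W.ΨSq m).eval ((W.Φ n).eval x / (W.ΨSq n).eval x) * (W.ΨSq n).eval x ^ m ^ 2 =
        (W.ΨSq (m * n)).eval x := by
  let f := algebraMap F (AlgebraicClosure F)
  have hf := f.injective
  obtain ⟨y, hy, hψ⟩ := exists_nonsingular (W := W.map f) (x := f x) fun k hk ↦ by
    simpa [eval_map_apply] using h k hk
  constructor
  · have := eval_Φ_mul hy hψ hn m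
    simp only [map_Φ, map_ΨSq, eval_map_apply, ← map_div₀, ← map_pow, ← map_mul] at this
    exact hf this
  · have := eval_ΨSq_mul hy hψ hn m
    simp only [map_Φ, map_ΨSq, eval_map_apply, ← map_div₀, ← map_pow, ← map_mul] at this
    exact hf this

end Generic
end WeierstrassCurve.Affine

/-! ### Homogenization of polynomials and its partial derivatives -/

namespace Polynomial

variable {R A : Type*} [CommRing R] [CommRing A] [Algebra R A] {p : R[X]} {N : ℕ}
  {g : Fin 2 → A} {t : A}

lemma aeval_homogenize (hp : p.natDegree ≤ N) (hg : g 0 = t * g 1) :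
    MvPolynomial.aeval g (p.homogenize N) = g 1 ^ N * aeval t p := by
  refine induction_with_natDegree_le
    (fun p ↦ MvPolynomial.aeval g (p.homogenize N) = g 1 ^ N * aeval t p) N
    (by simp) (fun n r _ hn ↦ ?_) (fun p q _ _ hp hq ↦ ?_) p hp
  · obtain ⟨k, rfl⟩ := Nat.exists_eq_add_of_le hn
    simp [homogenize_C_mul, homogenize_X_pow hn, hg]
    ring
  · simp only [homogenize_add, map_add, hp, hq]
    ring

lemma aeval_pderiv_zero_homogenize (hp : p.natDegree ≤ N) (hg : g 0 = t * g 1) :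
    MvPolynomial.aeval g (MvPolynomial.pderiv 0 (p.homogenize N)) * g 1 =
      g 1 ^ N * aeval t (derivative p) := by
  refine induction_with_natDegree_le
    (fun p ↦ MvPolynomial.aeval g (MvPolynomial.pderiv 0 (p.homogenize N)) * g 1 =
      g 1 ^ N * aeval t (derivative p)) N
    (by simp) (fun n r _ hn ↦ ?_) (fun p q _ _ hp hq ↦ ?_) p hp
  · obtain ⟨k, rfl⟩ := Nat.exists_eq_add_of_le hn
    rcases n with _ | n <;>
    simp [homogenize_C_mul, homogenize_X_pow hn, MvPolynomial.pderiv_X, hg]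
    ring
  · simp only [homogenize_add, map_add, add_mul, hp, hq]
    ring

lemma aeval_pderiv_one_homogenize (hp : p.natDegree ≤ N) (hg : g 0 = t * g 1) :
    MvPolynomial.aeval g (MvPolynomial.pderiv 1 (p.homogenize N)) * g 1 ^ 2 =
      g 1 ^ N * (N * g 1 * aeval t p - g 0 * aeval t (derivative p)) := by
  refine induction_with_natDegree_le
    (fun p ↦ MvPolynomial.aeval g (MvPolynomial.pderiv 1 (p.homogenize N)) * g 1 ^ 2 =
      g 1 ^ N * (N * g 1 * aeval t p - g 0 * aeval t (derivative p))) N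
    (by simp) (fun n r _ hn ↦ ?_) (fun p q _ _ hp hq ↦ ?_) p hp
  · obtain ⟨k, rfl⟩ := Nat.exists_eq_add_of_le hn
    rcases n with _ | n <;> rcases k with _ | k <;>
    simp [homogenize_C_mul, homogenize_X_pow hn, MvPolynomial.pderiv_X, hg] <;>
    ring
  · simp only [homogenize_add, map_add, add_mul, hp, hq]
    ring

/-- Substitution of `(1, 0)` leaves the coefficient of `X ^ N`. -/
lemma bind₁_homogenize_one_zero (hp : p.natDegree ≤ N) :
    MvPolynomial.bind₁ (![1, 0] : Fin 2 → MvPolynomial (Fin 2) R) (p.homogenize N) =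
      MvPolynomial.C (p.coeff N) := by
  refine induction_with_natDegree_le
    (fun p ↦ MvPolynomial.bind₁ (![1, 0] : Fin 2 → MvPolynomial (Fin 2) R) (p.homogenize N) =
      MvPolynomial.C (p.coeff N)) N
    (by simp) (fun n r _ hn ↦ ?_) (fun p q _ _ hp hq ↦ ?_) p hp
  · obtain ⟨k, rfl⟩ := Nat.exists_eq_add_of_le hn
    rcases k with _ | k <;>
    simp [homogenize_C_mul, homogenize_X_pow hn, coeff_X_pow]
  · simp only [homogenize_add, map_add, hp, hq, coeff_add]

end Polynomial

namespace MatrixEDS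

/-! ### The maps `[n]` and their Jacobian matrices -/

open MvPolynomial in
/-- The chain rule. -/
lemma AffineEnd.jacobian_comp {d R : Type*} [Fintype d] [CommRing R] (F G : AffineEnd d R) :
    (F.comp G).jacobian = F.jacobian.map (bind₁ G) * G.jacobian := by
  classical
  ext1 i j
  simp only [jacobian, comp, Matrix.mul_apply, Matrix.map_apply, Matrix.of_apply]
  induction F i using MvPolynomial.induction_on with
  | C a => simp
  | add p q hp hq => simp [hp, hq, add_mul, Finset.sum_add_distrib]
  | mul_X p k h =>
    simp only [map_mul, bind₁_X_right, Derivation.leibniz, smul_eq_mul, h, map_add, pderiv_X,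
      add_mul, Finset.sum_add_distrib, Finset.mul_sum, Pi.single_apply, apply_ite (bind₁ G),
      map_zero, mul_ite, mul_one, mul_zero, ite_mul, zero_mul,
      Finset.sum_ite_eq, Finset.mem_univ, if_true, mul_assoc]

open Polynomial

instance : E.IsShortNF := ⟨rfl, rfl, rfl⟩

lemma natDegree_phi_le (n : ℕ) : (phi n).natDegree ≤ n ^ 2 := by
  exact (E.natDegree_Φ_le n).trans (by simp)

lemma natDegree_psiSq_le (n : ℕ) : (psiSq n).natDegree ≤ n ^ 2 :=
  (E.natDegree_ΨSq_le n).trans (by simp)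

lemma coeff_phi (n : ℕ) : (phi n).coeff (n ^ 2) = 1 := by
  have := E.coeff_Φ n
  rwa [Int.natAbs_natCast] at this

/-- The polynomial `ψₙ²` has degree below `n²`, so `[n]` fixes the point `(1, 0)` above infinity. -/
lemma coeff_psiSq (n : ℕ) : (psiSq n).coeff (n ^ 2) = 0 := by
  rcases Nat.eq_zero_or_pos n with rfl | hn
  · simp [psiSq]
  · have h := E.natDegree_ΨSq_le n
    refine coeff_eq_zero_of_natDegree_lt (h.trans_lt ?_)
    have : 0 < n ^ 2 := by positivity
    simpa using this

lemma zK_ne_zero : zK ≠ 0 := by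
  simp [zK, MvPolynomial.X_ne_zero]

lemma xK_eq : xK = xK / zK * zK := (div_mul_cancel₀ _ zK_ne_zero).symm

lemma algebraMap_eq_aeval (p : MvPolynomial (Fin 2) S) :
    algebraMap (MvPolynomial (Fin 2) S) K p = MvPolynomial.aeval ![xK, zK] p := by
  have : IsScalarTower.toAlgHom S (MvPolynomial (Fin 2) S) K = MvPolynomial.aeval ![xK, zK] := by
    ext i
    fin_cases i <;> simp [xK, zK]
  exact congr($this p)

lemma algebraMap_homogenize {f : S[X]} {N : ℕ} (hf : f.natDegree ≤ N) :
    algebraMap (MvPolynomial (Fin 2) S) K (f.homogenize N) = zK ^ N * atXZ f := by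
  rw [algebraMap_eq_aeval, aeval_homogenize hf (t := xK / zK) xK_eq]
  rfl

lemma algebraMap_mulMap_zero (n : ℕ) :
    algebraMap (MvPolynomial (Fin 2) S) K (mulMap n 0) = zK ^ (n ^ 2) * atXZ (phi n) :=
  algebraMap_homogenize (natDegree_phi_le n)

lemma algebraMap_mulMap_one (n : ℕ) :
    algebraMap (MvPolynomial (Fin 2) S) K (mulMap n 1) = zK ^ (n ^ 2) * atXZ (psiSq n) :=
  algebraMap_homogenize (natDegree_psiSq_le n)

lemma atXZ_ne_zero {f : S[X]} (hf : f ≠ 0) : atXZ f ≠ 0 := by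
  intro h
  have := algebraMap_homogenize (f := f) le_rfl
  rw [h, mul_zero, FaithfulSMul.algebraMap_eq_zero_iff, homogenize_eq_zero_iff le_rfl] at this
  exact hf this

lemma atXZ_psiSq_ne_zero {n : ℕ} (hn : n ≠ 0) : atXZ (psiSq n) ≠ 0 :=
  atXZ_ne_zero (E.ΨSq_ne_zero (by exact_mod_cast hn))

lemma atXZ_eq_eval (f : S[X]) :
    atXZ f = (f.map (algebraMap S K)).eval (xK / zK) := by
  rw [atXZ, aeval_def, eval_map]

/-- The composition law at the transcendental element `X / Z`, where no `ψₖ²` with `k > 0`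
vanishes. -/
lemma atXZ_mul {n : ℕ} (hn : n ≠ 0) (m : ℕ) :
    aeval (atXZ (phi n) / atXZ (psiSq n)) (phi m) * atXZ (psiSq n) ^ m ^ 2 =
        atXZ (phi (m * n)) ∧
      aeval (atXZ (phi n) / atXZ (psiSq n)) (psiSq m) * atXZ (psiSq n) ^ m ^ 2 =
        atXZ (psiSq (m * n)) := by
  have := WeierstrassCurve.Affine.eval_comp (W := E.map (algebraMap S K)) (x := xK / zK)
    (fun k hk ↦ by
      rw [WeierstrassCurve.map_ΨSq, ← atXZ_eq_eval]
      exact atXZ_ne_zero (E.ΨSq_ne_zero (by exact_mod_cast hk.ne')))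
    (n := n) (by exact_mod_cast Nat.pos_of_ne_zero hn) m
  simpa only [WeierstrassCurve.map_ΨSq, WeierstrassCurve.map_Φ, atXZ_eq_eval, aeval_def,
    eval_map, phi, psiSq, Nat.cast_mul] using this

lemma mulMap_zero : mulMap 0 = ![1, 0] := by
  simp [mulMap, phi, psiSq]

theorem mulMap_mul (m n : ℕ) : mulMap (m * n) = (mulMap m).comp (mulMap n) := by
  rcases eq_or_ne n 0 with rfl | hn
  -- The map `[0]` is constant with value `(1, 0)`, which has no quotient `X / Z`.
  · ext1 i
    rw [mul_zero, AffineEnd.comp, mulMap_zero]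
    fin_cases i
    · simp [mulMap, bind₁_homogenize_one_zero (natDegree_phi_le m), coeff_phi]
    · simp [mulMap, bind₁_homogenize_one_zero (natDegree_psiSq_le m), coeff_psiSq]
  have key {f : S[X]} (hf : f.natDegree ≤ m ^ 2) :
      algebraMap (MvPolynomial (Fin 2) S) K (MvPolynomial.bind₁ (mulMap n) (f.homogenize (m ^ 2))) =
        zK ^ ((m * n) ^ 2) *
          (aeval (atXZ (phi n) / atXZ (psiSq n)) f * atXZ (psiSq n) ^ m ^ 2) := by
    rw [algebraMap_eq_aeval, MvPolynomial.aeval_bind₁]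
    simp only [← algebraMap_eq_aeval]
    rw [aeval_homogenize hf (t := atXZ (phi n) / atXZ (psiSq n)), algebraMap_mulMap_one]
    · ring
    · rw [algebraMap_mulMap_zero, algebraMap_mulMap_one]
      have := atXZ_psiSq_ne_zero hn
      field_simp
  ext1 i
  apply FaithfulSMul.algebraMap_injective (MvPolynomial (Fin 2) S) K
  fin_cases i
  · exact (algebraMap_mulMap_zero _).trans <| by
      rw [← (atXZ_mul hn m).1]; exact (key (natDegree_phi_le m)).symm
  · exact (algebraMap_mulMap_one _).trans <| by
      rw [← (atXZ_mul hn m).2]; exact (key (natDegree_psiSq_le m)).symm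

lemma mulMap_apply_zero_ne_zero (n : ℕ) : mulMap n 0 ≠ 0 :=
  (homogenize_eq_zero_iff (natDegree_phi_le n)).not.mpr (E.Φ_ne_zero n)

lemma isHomogeneous_mulMap_apply_zero (n : ℕ) : (mulMap n 0).IsHomogeneous (n ^ 2) :=
  isHomogeneous_homogenize (phi n)

lemma mulMap_injective : Function.Injective mulMap := by
  intro m n h
  have hn := isHomogeneous_mulMap_apply_zero n
  rw [← h] at hn
  have := (isHomogeneous_mulMap_apply_zero m).inj_right hn (mulMap_apply_zero_ne_zero m)
  exact Nat.pow_left_injective two_ne_zero this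

lemma zpow_sub_two_mul {n : ℕ} {a b : K} (h : a * zK ^ 2 = zK ^ (n ^ 2) * b) :
    a = zK ^ ((n : ℤ) ^ 2 - 2) * b := by
  rw [zpow_sub₀ zK_ne_zero]
  have := zK_ne_zero
  rw [div_mul_eq_mul_div, eq_div_iff (by simpa)]
  exact_mod_cast h

lemma map_J (n : ℕ) :
    (J n).map (algebraMap (MvPolynomial (Fin 2) S) K) =
      zK ^ ((n : ℤ) ^ 2 - 2) •
        !![zK * atXZ (derivative (phi n)),
            (n : K) ^ 2 * zK * atXZ (phi n) - xK * atXZ (derivative (phi n));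
          zK * atXZ (derivative (psiSq n)),
            (n : K) ^ 2 * zK * atXZ (psiSq n) - xK * atXZ (derivative (psiSq n))] := by
  have h₀ {f : S[X]} (hf : f.natDegree ≤ n ^ 2) :
      algebraMap (MvPolynomial (Fin 2) S) K (MvPolynomial.pderiv 0 (f.homogenize (n ^ 2))) =
        zK ^ ((n : ℤ) ^ 2 - 2) * (zK * atXZ (derivative f)) := by
    apply zpow_sub_two_mul
    have := aeval_pderiv_zero_homogenize hf (g := ![xK, zK]) xK_eq
    rw [← algebraMap_eq_aeval] at this
    change _ * zK = zK ^ n ^ 2 * atXZ (derivative f) at this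
    linear_combination zK * this
  have h₁ {f : S[X]} (hf : f.natDegree ≤ n ^ 2) :
      algebraMap (MvPolynomial (Fin 2) S) K (MvPolynomial.pderiv 1 (f.homogenize (n ^ 2))) =
        zK ^ ((n : ℤ) ^ 2 - 2) *
          ((n : K) ^ 2 * zK * atXZ f - xK * atXZ (derivative f)) := by
    apply zpow_sub_two_mul
    have := aeval_pderiv_one_homogenize hf (g := ![xK, zK]) xK_eq
    rw [← algebraMap_eq_aeval] at this
    push_cast at this
    exact this
  ext i j
  fin_cases i <;> fin_cases j
  · exact h₀ (natDegree_phi_le n)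
  · exact h₁ (natDegree_phi_le n)
  · exact h₀ (natDegree_psiSq_le n)
  · exact h₁ (natDegree_psiSq_le n)

lemma algebraMap_det_J (n : ℕ) :
    algebraMap (MvPolynomial (Fin 2) S) K (J n).det =
      (n : K) ^ 2 * zK ^ (2 * ((n : ℤ) ^ 2 - 1)) * atXZ (W (phi n) (psiSq n)) := by
  rw [RingHom.map_det, RingHom.mapMatrix_apply, map_J, Matrix.det_smul, Matrix.det_fin_two_of]
  have hz : zK ^ (2 * ((n : ℤ) ^ 2 - 1)) = (zK ^ ((n : ℤ) ^ 2 - 2)) ^ 2 * zK ^ 2 := by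
    rw [← zpow_natCast, ← zpow_natCast, ← zpow_mul, ← zpow_add₀ zK_ne_zero]
    congr 1
    push_cast
    ring
  rw [hz]
  simp only [W, atXZ, map_sub, map_mul, Fintype.card_fin]
  ring

/-- The chain rule turns `[mn] = [m] ∘ [n]` into a factorization of `J (m * n)`. -/
lemma J_mul (m n : ℕ) : J (m * n) = (J m).map (MvPolynomial.bind₁ (mulMap n)) * J n := by
  rw [J, mulMap_mul, AffineEnd.jacobian_comp]
  rfl

lemma isMatrixDvdSequence_J : IsMatrixDvdSequence J := by
  rintro m _ ⟨k, rfl⟩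
  exact ⟨_, J_mul k m⟩

lemma IsMatrixDvdSequence.map {Γ d R R' : Type*} [Mul Γ] [Fintype d] [CommRing R] [CommRing R']
    {M : Γ → Matrix d d R} (hM : IsMatrixDvdSequence M) (f : R →+* R') :
    IsMatrixDvdSequence fun n ↦ (M n).map f := by
  intro m n h
  obtain ⟨Q, hQ⟩ := hM m n h
  exact ⟨Q.map f, by simp [hQ, Matrix.map_mul]⟩

lemma IsMatrixDvdSequence.det_dvd_det {d R : Type*} [Fintype d] [DecidableEq d] [CommRing R]
    {M : ℕ → Matrix d d R} (hM : IsMatrixDvdSequence M) {m n : ℕ} (h : m ∣ n) :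
    (M m).det ∣ (M n).det := by
  obtain ⟨Q, hQ⟩ := hM m n (h.imp fun c hc ↦ hc.trans (mul_comm _ _))
  rw [hQ, Matrix.det_mul]
  exact dvd_mul_left _ _

end MatrixEDS
open MatrixEDS in
theorem mainTheorem4 :
    -- `[n](X, Z) = (Z^(n²) φₙ(X/Z), Z^(n²) ψₙ²(X/Z))`
    (∀ n : ℕ,
      algebraMap (MvPolynomial (Fin 2) S) K (mulMap n 0) = zK ^ (n ^ 2) * atXZ (phi n) ∧
      algebraMap (MvPolynomial (Fin 2) S) K (mulMap n 1) = zK ^ (n ^ 2) * atXZ (psiSq n)) ∧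
    -- `[·]` is a faithful representation of the multiplicative semigroup `ℕ`
    (∀ m n : ℕ, mulMap (m * n) = (mulMap m).comp (mulMap n)) ∧
    Function.Injective mulMap ∧
    -- the explicit form of the Jacobian matrix `Jₙ` of `[n]`
    (∀ n : ℕ,
      (J n).map (algebraMap (MvPolynomial (Fin 2) S) K) =
        zK ^ ((n : ℤ) ^ 2 - 2) •
          !![zK * atXZ (Polynomial.derivative (phi n)),
              (n : K) ^ 2 * zK * atXZ (phi n) - xK * atXZ (Polynomial.derivative (phi n));
            zK * atXZ (Polynomial.derivative (psiSq n)),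
              (n : K) ^ 2 * zK * atXZ (psiSq n) -
                xK * atXZ (Polynomial.derivative (psiSq n))]) ∧
    -- `(Jₙ)` is a matrix divisibility sequence, as are its values at points of `𝔸²`
    IsMatrixDvdSequence J ∧
    (∀ (S' : Type*) [CommRing S'] [Algebra S S'] (P : Fin 2 → S'),
      IsMatrixDvdSequence fun n : ℕ => (J n).map (MvPolynomial.aeval P)) ∧
    -- the associated determinant sequence, and its values at points, are divisibility sequences
    (∀ m n : ℕ, m ∣ n → (J m).det ∣ (J n).det) ∧
    (∀ (S' : Type*) [CommRing S'] [Algebra S S'] (P : Fin 2 → S') (m n : ℕ), m ∣ n →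
      ((J m).map (MvPolynomial.aeval P)).det ∣ ((J n).map (MvPolynomial.aeval P)).det) ∧
    -- the formula for the determinants
    (∀ n : ℕ,
      algebraMap (MvPolynomial (Fin 2) S) K (J n).det =
        (n : K) ^ 2 * zK ^ (2 * ((n : ℤ) ^ 2 - 1)) * atXZ (W (phi n) (psiSq n))) := by
  exact ⟨fun n ↦ ⟨algebraMap_mulMap_zero n, algebraMap_mulMap_one n⟩, mulMap_mul, mulMap_injective,
    map_J, isMatrixDvdSequence_J,
    fun S' _ _ P ↦ isMatrixDvdSequence_J.map (MvPolynomial.aeval P : _ →ₐ[S] S').toRingHom,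
    fun m n h ↦ isMatrixDvdSequence_J.det_dvd_det h,
    fun S' _ _ P m n h ↦ (isMatrixDvdSequence_J.map
      (MvPolynomial.aeval P : _ →ₐ[S] S').toRingHom).det_dvd_det h,
    algebraMap_det_J⟩
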